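/- A unit weighing matrix $UW(n,p)$ is an $n\times n$ complex matrix $W$ whose entries all have absolute value $0$ or $1$ and which satisfies $WW^*=pI_n$. Two matrices $H,K$ of type $UW(n,p)$ are unbiased if $HK^*=\sqrt p\,L$ for some $UW(n,p)$ matrix $L$; a set of $UW(n,p)$ matrices is mutually unbiased if any two distinct members are unbiased. Two such matrices $H,K$ are equivalent if $H=PKQ$, where $P$ and $Q$ have exactly one nonzero entry in each row and each column and these entries have absolute value $1$. Put $a=e^{2\pi i/3}$ and $$W_5=\begin{pmatrix}1&1&1&1&0\\1&a&\bar a&0&1\\1&\bar a&0&a&\bar a\\1&0&a&\bar a&a\\0&1&\bar a&a&a\end{pmatrix}.$$ **Theorem.** The largest cardinality of a set of mutually unbiased $UW(5,4)$ matrices is exactly $5$. Moreover: 1. $W_5$ is a $UW(5,4)$, and every $UW(5,4)$ is equivalent to $W_5$. 2. If $W$ is a $UW(5,4)$ unbiased with $W_5$ and the first nonzero entry of each row of $W$ is $1$, then every nonzero entry of $W$ is a sixth root of unity. 3. $W_5$ and the following four matrices are five distinct matrices forming a mutually unbiased set of $UW(5,4)$: $$\begin{pmatrix}1&1&1&-1&0\\1&a&\bar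 a&0&-1\\1&\bar a&0&-a&-\bar a\\1&0&a&-\bar a&-a\\0&1&\bar a&-a&-a\end{pmatrix},\quad \begin{pmatrix}1&1&-1&1&0\\1&a&-\bar a&0&-1\\1&\bar a&0&a&-\bar a\\1&0&-a&\bar a&-a\\0&1&-\bar a&a&-a\end{pmatrix},$$ $$\begin{pmatrix}1&-\bar a&0&a&-\bar a\\1&-1&1&1&0\\1&-a&\bar a&0&-1\\1&0&a&\bar a&-a\\0&1&-\bar a&-a&a\end{pmatrix},\quad \begin{pmatrix}1&-\bar a&0&-a&\bar a\\1&-1&-1&-1&0\\1&-a&-\bar a&0&1\\1&0&-a&-\bar a&a\\0&1&\bar a&a&-a\end{pmatrix}.$$ -/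

import Mathlib

open scoped Matrix ComplexConjugate

noncomputable section

namespace UnitWeighing

/-- `W` is a unit weighing matrix `UW(n, p)`: every entry has absolute value `0` or `1`,
and `W W* = p I`. -/
def IsUW {n : ℕ} (p : ℕ) (W : Matrix (Fin n) (Fin n) ℂ) : Prop :=
  (∀ i j, ‖W i j‖ = 0 ∨ ‖W i j‖ = 1) ∧
    W * Wᴴ = (p : ℂ) • (1 : Matrix (Fin n) (Fin n) ℂ)

/-- Two unit weighing matrices `H`, `K` of type `UW(n, p)` are unbiased if `H K* = √p L` for
some `UW(n, p)` matrix `L`. -/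
def Unbiased {n : ℕ} (p : ℕ) (H K : Matrix (Fin n) (Fin n) ℂ) : Prop :=
  IsUW p H ∧ IsUW p K ∧
    ∃ L : Matrix (Fin n) (Fin n) ℂ, IsUW p L ∧ H * Kᴴ = ((Real.sqrt p : ℝ) : ℂ) • L

/-- A set of mutually unbiased unit weighing matrices `UW(n, p)`. -/
def MutuallyUnbiased {n : ℕ} (p : ℕ) (S : Set (Matrix (Fin n) (Fin n) ℂ)) : Prop :=
  (∀ W ∈ S, IsUW p W) ∧ S.Pairwise (Unbiased p)

/-- Unimodular permutation matrices: every row and every column has exactly one nonzero entry,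
and the nonzero entries have absolute value `1`. -/
def IsUnimodularPerm {n : ℕ} (P : Matrix (Fin n) (Fin n) ℂ) : Prop :=
  (∀ i, ∃! j, P i j ≠ 0) ∧ (∀ j, ∃! i, P i j ≠ 0) ∧ ∀ i j, P i j ≠ 0 → ‖P i j‖ = 1

/-- `H` and `K` are equivalent if `H = P K Q` for unimodular permutation matrices `P`, `Q`. -/
def Equivalent {n : ℕ} (H K : Matrix (Fin n) (Fin n) ℂ) : Prop :=
  ∃ P Q : Matrix (Fin n) (Fin n) ℂ,
    IsUnimodularPerm P ∧ IsUnimodularPerm Q ∧ H = P * K * Q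

/-- The first nonzero entry of every row is `1`. -/
def RowNormalized {n : ℕ} (W : Matrix (Fin n) (Fin n) ℂ) : Prop :=
  ∀ i j, W i j ≠ 0 → (∀ k, k < j → W i k = 0) → W i j = 1

/-- The primitive third root of unity `a = e ^ (2πi/3)`. -/
def a : ℂ := Complex.exp (2 * Real.pi * Complex.I / 3)

/-- The matrix `W₅`. -/
def W5 : Matrix (Fin 5) (Fin 5) ℂ :=
  !![1, 1, 1, 1, 0;
     1, a, conj a, 0, 1;
     1, conj a, 0, a, conj a;
     1, 0, a, conj a, a;
     0, 1, conj a, a, a]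

/-- The explicit list of five mutually unbiased `UW(5, 4)`. -/
def listUW54 : Fin 5 → Matrix (Fin 5) (Fin 5) ℂ :=
  ![W5,
    !![1, 1, 1, -1, 0;
       1, a, conj a, 0, -1;
       1, conj a, 0, -a, -conj a;
       1, 0, a, -conj a, -a;
       0, 1, conj a, -a, -a],
    !![1, 1, -1, 1, 0;
       1, a, -conj a, 0, -1;
       1, conj a, 0, a, -conj a;
       1, 0, -a, conj a, -a;
       0, 1, -conj a, a, -a],
    !![1, -conj a, 0, a, -conj a;
       1, -1, 1, 1, 0;
       1, -a, conj a, 0, -1;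
       1, 0, a, conj a, -a;
       0, 1, -conj a, -a, a],
    !![1, -conj a, 0, -a, conj a;
       1, -1, -1, -1, 0;
       1, -a, -conj a, 0, 1;
       1, 0, -a, -conj a, a;
       0, 1, conj a, a, -a]]

end UnitWeighing

end

namespace UnitWeighing

/-! Each row of a UW(5,4) has exactly one zero, and the zeros form a permutation pattern. Two
distinct rows therefore overlap in three columns, and orthogonality makes the three unimodular
products there an equilateral triangle: up to a scalar they are `1`, `a`, `a ^ 2`. This rigidity
drives everything.

If `M` and `W` are unbiased, every inner product of a row of `M` with a row of `W` has modulus 0 or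
2, and each row of `W` is orthogonal to some row of `M`. For rows with a common zero this forces the
four entrywise ratios to agree up to sign (`Unbiased.ratio_eq_or_eq_neg`). Orthogonality within `W`
then makes the signs depend only on the column, so `W` is `M` with signed columns, up to permuting
and rescaling rows (`Unbiased.exists_signScaling`). As 5 is odd, the sign vector can be chosen with
product 1.

In a mutually unbiased set, all members are thus encoded by sign vectors relative to one member. For
two members, the entrywise product of the vectors has exactly two minus signs, so the vectors have
inner product 1 and squared norm 5. Such vectors are linearly independent in dimension 5, which
gives the bound. Conversely, suitable sign vectors do give unbiased matrices, which yields the list.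
Uniqueness up to equivalence comes from normalizing a border and applying the triangle rigidity to
the core. -/

/-! ### Unimodular numbers with zero sum -/

lemma a_pow_three : a ^ 3 = 1 := by
  rw [a, ← Complex.exp_nat_mul, ← Complex.exp_two_pi_mul_I]
  congr 1
  push_cast
  ring

lemma norm_a : ‖a‖ = 1 := by
  have h : (2 * Real.pi * Complex.I / 3 : ℂ) = ((2 * Real.pi / 3 : ℝ) : ℂ) * Complex.I := by
    push_cast
    ring
  rw [a, h, Complex.norm_exp_ofReal_mul_I]

lemma a_ne_one : a ≠ 1 := by
  intro h
  have := (Complex.isPrimitiveRoot_exp 3 (by norm_num)).ne_one (by norm_num)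
  apply this
  rw [← h, a]
  push_cast
  rfl

lemma one_add_a_add_sq : 1 + a + a ^ 2 = 0 := by
  have h : (a - 1) * (1 + a + a ^ 2) = 0 := by linear_combination a_pow_three
  exact (mul_eq_zero.mp h).resolve_left (sub_ne_zero.mpr a_ne_one)

lemma a_ne_zero : a ≠ 0 := by
  intro h
  simpa [h] using norm_a

lemma conj_eq_inv {x : ℂ} (hx : ‖x‖ = 1) : conj x = x⁻¹ :=
  (Complex.inv_eq_conj hx).symm

lemma ne_zero_of_norm_eq_one {x : ℂ} (hx : ‖x‖ = 1) : x ≠ 0 := by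
  rintro rfl
  simp at hx

lemma conj_mul_self_of_norm_eq_one {x : ℂ} (hx : ‖x‖ = 1) : conj x * x = 1 := by
  rw [conj_eq_inv hx, inv_mul_cancel₀ (ne_zero_of_norm_eq_one hx)]

lemma conj_a : conj a = a ^ 2 := by
  rw [conj_eq_inv norm_a]
  field_simp [a_ne_zero]
  rw [← a_pow_three]

/-- The second symmetric function of three unimodular numbers with zero sum vanishes. -/
lemma symm_two_eq_zero {x y z : ℂ} (hx : ‖x‖ = 1) (hy : ‖y‖ = 1) (hz : ‖z‖ = 1)
    (h : x + y + z = 0) : x * y + y * z + z * x = 0 := by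
  have h' := congrArg conj h
  simp only [map_add, map_zero, conj_eq_inv hx, conj_eq_inv hy, conj_eq_inv hz] at h'
  have h1 := ne_zero_of_norm_eq_one hx
  have h2 := ne_zero_of_norm_eq_one hy
  have h3 := ne_zero_of_norm_eq_one hz
  field_simp at h'
  linear_combination h'

/-- Three unimodular numbers with zero sum are the vertices of an equilateral triangle. -/
lemma eq_a_mul_of_sum_eq_zero {x y z : ℂ} (hx : ‖x‖ = 1) (hy : ‖y‖ = 1) (hz : ‖z‖ = 1)
    (h : x + y + z = 0) : (y = a * x ∧ z = a ^ 2 * x) ∨ (y = a ^ 2 * x ∧ z = a * x) := by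
  have h2 := symm_two_eq_zero hx hy hz h
  have h3 := one_add_a_add_sq
  have h4 := a_pow_three
  have : (y - a * x) * (y - a ^ 2 * x) = 0 := by
    linear_combination (x + y) * h - h2 - x * y * h3 + x ^ 2 * h4
  rcases mul_eq_zero.mp this with h5 | h5
  · left
    refine ⟨by linear_combination h5, ?_⟩
    linear_combination h - h5 - x * h3
  · right
    refine ⟨by linear_combination h5, ?_⟩
    linear_combination h - h5 - x * h3

/-! ### Rigidity of the ratios between two rows -/

lemma mul_conj_of_norm_eq_two {x : ℂ} (hx : ‖x‖ = 2) : x * conj x = 4 := by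
  rw [Complex.mul_conj', hx]
  norm_num

/-- If two of three unimodular numbers are opposite, and their combination with weights of zero sum
has absolute value `0` or `2`, then they are equal up to sign. -/
lemma eq_or_eq_neg_of_opposite {x z u v w : ℂ} (hx : ‖x‖ = 1) (hz : ‖z‖ = 1)
    (hu : ‖u‖ = 1) (hv : ‖v‖ = 1) (hw : ‖w‖ = 1) (huvw : u + v + w = 0)
    (h : ‖x * u - x * v + z * w‖ = 0 ∨ ‖x * u - x * v + z * w‖ = 2) : z = x ∨ z = -x := by
  have e2 := symm_two_eq_zero hu hv hw huvw
  have x0 := ne_zero_of_norm_eq_one hx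
  have z0 := ne_zero_of_norm_eq_one hz
  have u0 := ne_zero_of_norm_eq_one hu
  have v0 := ne_zero_of_norm_eq_one hv
  have w0 := ne_zero_of_norm_eq_one hw
  -- A side of the triangle is perpendicular to the opposite vertex and `√3` times as long.
  have hsq : (u - v) ^ 2 = -3 * w ^ 2 := by
    linear_combination (u + v + 3 * w) * huvw - 4 * e2
  -- Modulus 0 would equate lengths `√3` and 1. Modulus 2 squared is 3 + 1 plus a cross term, which
  -- must vanish; by perpendicularity this makes `z / x` real.
  rcases h with h | h
  · exfalso
    rw [norm_eq_zero] at h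
    have h1 : w ^ 2 * z ^ 2 = w ^ 2 * (-3 * x ^ 2) := by
      linear_combination (z * w - x * u + x * v) * h + x ^ 2 * hsq
    have h2 := congrArg norm (mul_left_cancel₀ (pow_ne_zero 2 w0) h1)
    simp [hx, hz] at h2
  · have h1 := mul_conj_of_norm_eq_two h
    simp only [map_add, map_sub, map_mul, conj_eq_inv hx, conj_eq_inv hz, conj_eq_inv hu,
      conj_eq_inv hv, conj_eq_inv hw] at h1
    have huv : u * v = w ^ 2 := by linear_combination e2 - w * huvw
    have hne : u - v ≠ 0 := by
      intro h0
      rw [h0] at hsq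
      have : w ^ 2 = 0 := by linear_combination (1 / 3) * hsq
      exact pow_ne_zero 2 w0 this
    field_simp at h1
    have h3 : (z - x) * (z + x) * ((u - v) * w ^ 2) = 0 := by
      linear_combination -h1 + (x * (x * (u - v) + z * w) - 4 * x * z * w) * huv - x * z * w * hsq
    have h4 := (mul_eq_zero.mp h3).resolve_right (mul_ne_zero hne (pow_ne_zero 2 w0))
    rcases mul_eq_zero.mp h4 with h5 | h5
    · exact Or.inl (sub_eq_zero.mp h5)
    · exact Or.inr (eq_neg_of_add_eq_zero_left h5)

/-- Four unimodular numbers of zero sum split into two opposite pairs: conjugating the relation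
kills the third symmetric function, hence the product `key`. Each pairing reduces to
`eq_or_eq_neg_of_opposite`. -/
lemma eq_or_eq_neg_of_sum_eq_zero {p q r s u v w : ℂ} (hp : ‖p‖ = 1) (hq : ‖q‖ = 1)
    (hr : ‖r‖ = 1) (hs : ‖s‖ = 1) (hu : ‖u‖ = 1) (hv : ‖v‖ = 1) (hw : ‖w‖ = 1)
    (huvw : u + v + w = 0) (hsum : s + p + q + r = 0)
    (h : ‖p * u + q * v + r * w‖ = 0 ∨ ‖p * u + q * v + r * w‖ = 2) :
    (s = p ∨ s = -p) ∧ (q = p ∨ q = -p) ∧ (r = p ∨ r = -p) := by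
  have p0 := ne_zero_of_norm_eq_one hp
  have q0 := ne_zero_of_norm_eq_one hq
  have r0 := ne_zero_of_norm_eq_one hr
  have s0 := ne_zero_of_norm_eq_one hs
  have hconj := congrArg conj hsum
  simp only [map_add, map_zero, conj_eq_inv hp, conj_eq_inv hq, conj_eq_inv hr,
    conj_eq_inv hs] at hconj
  field_simp at hconj
  have key : (p + q) * ((p + r) * (q + r)) = 0 := by
    linear_combination (p * q + q * r + r * p) * hsum - hconj
  rcases mul_eq_zero.mp key with h1 | h1
  · obtain rfl : q = -p := by linear_combination h1
    have := eq_or_eq_neg_of_opposite hp hr hu hv hw huvw (by convert h using 4 <;> ring)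
    obtain rfl : s = -r := by linear_combination hsum
    rcases this with rfl | rfl <;> simp
  rcases mul_eq_zero.mp h1 with h1 | h1
  · obtain rfl : r = -p := by linear_combination h1
    have := eq_or_eq_neg_of_opposite hp hq hu hw hv (by linear_combination huvw)
      (by convert h using 3 <;> ring)
    obtain rfl : s = -q := by linear_combination hsum
    rcases this with rfl | rfl <;> simp
  · obtain rfl : r = -q := by linear_combination h1
    have := eq_or_eq_neg_of_opposite hq hp hv hw hu (by linear_combination huvw)
      (by convert h using 3 <;> ring)
    obtain rfl : s = -p := by linear_combination hsum
    rcases this with rfl | rfl <;> simp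

/-- Both `u, v, w` and `p * u, q * v, r * w` are equilateral triangles. With the same orientation `p
= q = r`, and `s + 3 * p` has modulus at most 2 only for `s = -p`. With opposite orientations `p + q
+ r = 0`, leaving a sum of modulus 1, which is excluded. -/
lemma eq_of_weighted_sum_eq_zero {p q r s u v w : ℂ} (hp : ‖p‖ = 1) (hq : ‖q‖ = 1)
    (hr : ‖r‖ = 1) (hs : ‖s‖ = 1) (hu : ‖u‖ = 1) (hv : ‖v‖ = 1) (hw : ‖w‖ = 1)
    (huvw : u + v + w = 0) (h : p * u + q * v + r * w = 0)
    (hsum : ‖s + p + q + r‖ = 0 ∨ ‖s + p + q + r‖ = 2) :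
    s = -p ∧ q = p ∧ r = p := by
  have p0 := ne_zero_of_norm_eq_one hp
  have u0 := ne_zero_of_norm_eq_one hu
  have hA := one_add_a_add_sq
  have hB := a_pow_three
  have a0 := a_ne_zero
  have h1 := eq_a_mul_of_sum_eq_zero hu hv hw huvw
  have h2 := eq_a_mul_of_sum_eq_zero (x := p * u) (y := q * v) (z := r * w)
    (by simp [hp, hu]) (by simp [hq, hv]) (by simp [hr, hw]) h
  have equal : q = p ∧ r = p → s = -p ∧ q = p ∧ r = p := by
    rintro ⟨rfl, rfl⟩
    refine ⟨?_, rfl, rfl⟩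
    have s0 := ne_zero_of_norm_eq_one hs
    rcases hsum with h3 | h3
    · rw [norm_eq_zero] at h3
      have : s = -3 * r := by linear_combination h3
      have := congrArg norm this
      simp [hs, hp] at this
    · have h4 := mul_conj_of_norm_eq_two h3
      simp only [map_add, conj_eq_inv hp, conj_eq_inv hs] at h4
      field_simp at h4
      have : (s + r) ^ 2 = 0 := by linear_combination (1 / 3) * h4
      exact eq_neg_of_add_eq_zero_left (pow_eq_zero_iff (two_ne_zero) |>.mp this)
  have unequal : p + q + r = 0 → s = -p ∧ q = p ∧ r = p := by
    intro h3
    exfalso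
    have : s + p + q + r = s := by linear_combination h3
    rw [this, hs] at hsum
    norm_num at hsum
  rcases h1 with ⟨rfl, rfl⟩ | ⟨rfl, rfl⟩ <;> rcases h2 with ⟨h2, h3⟩ | ⟨h2, h3⟩
  · exact equal ⟨mul_right_cancel₀ (mul_ne_zero a0 u0) (by linear_combination h2),
      mul_right_cancel₀ (mul_ne_zero (pow_ne_zero 2 a0) u0) (by linear_combination h3)⟩
  · have hq' : q = a * p := mul_right_cancel₀ (mul_ne_zero a0 u0) (by linear_combination h2)
    have hr' : r = a ^ 2 * p := mul_right_cancel₀ (mul_ne_zero (pow_ne_zero 2 a0) u0)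
      (by linear_combination h3 - a * p * u * hB)
    exact unequal (by rw [hq', hr']; linear_combination p * hA)
  · have hq' : q = a ^ 2 * p := mul_right_cancel₀ (mul_ne_zero (pow_ne_zero 2 a0) u0)
      (by linear_combination h2 - a * p * u * hB)
    have hr' : r = a * p := mul_right_cancel₀ (mul_ne_zero a0 u0) (by linear_combination h3)
    exact unequal (by rw [hq', hr']; linear_combination p * hA)
  · exact equal ⟨mul_right_cancel₀ (mul_ne_zero (pow_ne_zero 2 a0) u0) (by linear_combination h2),
      mul_right_cancel₀ (mul_ne_zero a0 u0) (by linear_combination h3)⟩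

/-! ### Zero pattern and row overlaps of a UW(5,4) -/

variable {M W : Matrix (Fin 5) (Fin 5) ℂ}

lemma IsUW.conjTranspose_mul (h : IsUW 4 W) :
    Wᴴ * W = (4 : ℂ) • (1 : Matrix (Fin 5) (Fin 5) ℂ) := by
  have h1 : W * ((4 : ℂ)⁻¹ • Wᴴ) = 1 := by
    rw [Matrix.mul_smul, h.2, smul_smul]
    norm_num
  have h2 := mul_eq_one_comm.mp h1
  rw [Matrix.smul_mul] at h2
  rw [← h2, smul_smul]
  norm_num

lemma IsUW.conjTranspose (h : IsUW 4 W) : IsUW 4 Wᴴ := by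
  refine ⟨fun i j => by simpa using h.1 j i, ?_⟩
  rw [Matrix.conjTranspose_conjTranspose, h.conjTranspose_mul]
  norm_num

lemma IsUW.sum_mul_conj (h : IsUW 4 W) (i k : Fin 5) :
    ∑ j, W i j * conj (W k j) = if i = k then 4 else 0 := by
  have h1 := congrFun (congrFun h.2 i) k
  simpa [Matrix.mul_apply, Matrix.one_apply] using h1

lemma IsUW.norm_eq_one (h : IsUW 4 W) {i j : Fin 5} (hij : W i j ≠ 0) : ‖W i j‖ = 1 :=
  (h.1 i j).resolve_left (by simpa using hij)

/-- The squared norm 4 of a row counts its nonzero entries. -/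
lemma IsUW.existsUnique_zero (h : IsUW 4 W) (i : Fin 5) : ∃! j, W i j = 0 := by
  have h1 := h.sum_mul_conj i i
  have h2 : ∀ j, W i j * conj (W i j) = if W i j ≠ 0 then 1 else 0 := by
    intro j
    split_ifs with h0
    · rw [mul_comm, conj_mul_self_of_norm_eq_one (h.norm_eq_one h0)]
    · simp [not_not.mp h0]
  simp only [h2, if_true, Finset.sum_boole] at h1
  have h3 : (Finset.univ.filter fun j => W i j ≠ 0).card = 4 := by exact_mod_cast h1
  have h4 := Finset.card_filter_add_card_filter_not (s := Finset.univ) (fun j => W i j = 0)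
  have h5 : (Finset.univ.filter fun j => W i j = 0).card = 1 := by
    simp only [Finset.card_univ, Fintype.card_fin] at h4
    simp only [ne_eq] at h3
    omega
  obtain ⟨j, hj⟩ := Finset.card_eq_one.mp h5
  refine ⟨j, ?_, fun k hk => ?_⟩
  · have : j ∈ Finset.univ.filter fun j => W i j = 0 := by simp [hj]
    simpa using this
  · have : k ∈ Finset.univ.filter fun j => W i j = 0 := by simpa using hk
    simpa [hj] using this

/-- The zeros of a `UW(5, 4)` form a permutation pattern. -/
lemma IsUW.exists_perm (h : IsUW 4 W) :
    ∃ z : Equiv.Perm (Fin 5), ∀ i j, W i j = 0 ↔ j = z i := by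
  choose f hf hf' using h.existsUnique_zero
  have hinj : Function.Injective f := by
    intro i k hik
    have hc := h.conjTranspose.existsUnique_zero (f i)
    refine hc.unique ?_ ?_
    · simpa using hf i
    · simpa [hik] using hf k
  refine ⟨Equiv.ofBijective f (Finite.injective_iff_bijective.mp hinj), fun i j => ?_⟩
  constructor
  · exact hf' i j
  · rintro rfl
    exact hf i

/-! ### Rows of two unbiased matrices -/

lemma sqrt_four : Real.sqrt (4 : ℕ) = 2 := by
  rw [show ((4 : ℕ) : ℝ) = 2 ^ 2 by norm_num]
  exact Real.sqrt_sq (by norm_num)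

lemma sum_mul_conj_eq_two_mul {L : Matrix (Fin 5) (Fin 5) ℂ}
    (h : M * Wᴴ = ((Real.sqrt (4 : ℕ) : ℝ) : ℂ) • L) (i k : Fin 5) :
    ∑ l, M i l * conj (W k l) = 2 * L i k := by
  have h1 := congrFun (congrFun h i) k
  rw [sqrt_four] at h1
  simpa [Matrix.mul_apply] using h1

lemma Unbiased.norm_sum (h : Unbiased 4 M W) (i k : Fin 5) :
    ‖∑ l, M i l * conj (W k l)‖ = 0 ∨ ‖∑ l, M i l * conj (W k l)‖ = 2 := by
  obtain ⟨-, -, L, hL, hMW⟩ := h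
  rw [sum_mul_conj_eq_two_mul hMW]
  rcases hL.1 i k with h | h <;> simp [h]

lemma Unbiased.exists_sum_eq_zero (h : Unbiased 4 M W) (k : Fin 5) :
    ∃ i, ∑ l, M i l * conj (W k l) = 0 := by
  obtain ⟨-, -, L, hL, hMW⟩ := h
  obtain ⟨i, hi, -⟩ := hL.conjTranspose.existsUnique_zero k
  refine ⟨i, ?_⟩
  rw [sum_mul_conj_eq_two_mul hMW]
  simpa using hi

/-- Two distinct indices can be completed to an enumeration of `Fin 5`. -/
lemma exists_enumeration : ∀ j s : Fin 5, j ≠ s → ∃ p q r : Fin 5,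
    ({j, s, p, q, r} : Finset (Fin 5)) = Finset.univ ∧ j ≠ p ∧ j ≠ q ∧ j ≠ r ∧
      s ≠ p ∧ s ≠ q ∧ s ≠ r ∧ p ≠ q ∧ p ≠ r ∧ q ≠ r := by
  decide

/-- Enumeration of the columns of two distinct rows of a `UW(5, 4)` together with the
unimodular ratios of their common entries. -/
lemma IsUW.exists_enumeration (hM : IsUW 4 M) {i k j s : Fin 5} (hik : i ≠ k)
    (hi : M i j = 0) (hk : M k s = 0) : ∃ p q r : Fin 5,
      (∀ l, l = j ∨ l = s ∨ l = p ∨ l = q ∨ l = r) ∧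
      (∀ f : Fin 5 → ℂ, ∑ l, f l = f j + f s + f p + f q + f r) ∧
      (∀ l, l = s ∨ l = p ∨ l = q ∨ l = r → ‖M i l‖ = 1) ∧
      (∀ l, l = j ∨ l = p ∨ l = q ∨ l = r → ‖M k l‖ = 1) := by
  have hjs : j ≠ s := by
    rintro rfl
    exact hik ((hM.conjTranspose.existsUnique_zero j).unique (by simpa using hi) (by simpa using hk))
  obtain ⟨p, q, r, huniv, h1, h2, h3, h4, h5, h6, h7, h8, h9⟩ :=
    UnitWeighing.exists_enumeration j s hjs
  refine ⟨p, q, r, ?_, ?_, ?_, ?_⟩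
  · intro l
    have : l ∈ ({j, s, p, q, r} : Finset (Fin 5)) := by simp [huniv]
    simpa using this
  · intro f
    rw [← huniv, Finset.sum_insert (by simp [hjs, h1, h2, h3]),
      Finset.sum_insert (by simp [h4, h5, h6]), Finset.sum_insert (by simp [h7, h8]),
      Finset.sum_insert (by simp [h9]), Finset.sum_singleton]
    ring
  · intro l hl
    refine hM.norm_eq_one fun h0 => ?_
    have := (hM.existsUnique_zero i).unique h0 hi
    subst this
    rcases hl with rfl | rfl | rfl | rfl <;> simp_all
  · intro l hl
    refine hM.norm_eq_one fun h0 => ?_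
    have := (hM.existsUnique_zero k).unique h0 hk
    subst this
    rcases hl with rfl | rfl | rfl | rfl <;> simp_all

/-- Row `k` of `W` is orthogonal to some row of `M`. If that is row `i`, the plain sum of the ratios
vanishes; otherwise a triangle-weighted sum does. Each case has its own rigidity lemma. -/
lemma Unbiased.ratio_eq_or_eq_neg (h : Unbiased 4 M W) {i k j : Fin 5} (hi : M i j = 0)
    (hk : W k j = 0) : ∃ p, ‖M i p * conj (W k p)‖ = 1 ∧ ∀ l, l ≠ j →
      M i l * conj (W k l) = M i p * conj (W k p) ∨
      M i l * conj (W k l) = -(M i p * conj (W k p)) := by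
  have hM := h.1
  have hW := h.2.1
  -- If the orthogonal row is `i` itself, any other row of `M` supplies the weighted sum.
  obtain ⟨i', hi', hzero⟩ : ∃ i', i' ≠ i ∧ ((∑ l, M i l * conj (W k l) = 0) ∨
      ∑ l, M i' l * conj (W k l) = 0) := by
    obtain ⟨i', h0⟩ := h.exists_sum_eq_zero k
    by_cases hii : i' = i
    · obtain ⟨m, hm⟩ := exists_ne i
      exact ⟨m, hm, Or.inl (hii ▸ h0)⟩
    · exact ⟨i', hii, Or.inr h0⟩
  obtain ⟨s, hs, -⟩ := hM.existsUnique_zero i'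
  obtain ⟨p, q, r, hcov, hsum, hMi, hMi'⟩ :=
    hM.exists_enumeration hi'.symm hi hs
  have hWk : ∀ l, l ≠ j → ‖W k l‖ = 1 := fun l hl =>
    hW.norm_eq_one fun h0 => hl ((hW.existsUnique_zero k).unique h0 hk)
  have hMj : ∀ l, l ≠ j → ‖M i l‖ = 1 := fun l hl =>
    hM.norm_eq_one fun h0 => hl ((hM.existsUnique_zero i).unique h0 hi)
  have hne : ∀ l, ‖M i l‖ = 1 → l ≠ j := by
    rintro l hl rfl
    simp [hi] at hl
  have hp := hMi p (by simp)
  have hq := hMi q (by simp)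
  have hr := hMi r (by simp)
  have hs1 := hMi s (by simp)
  have hx : ∀ l, l ≠ j → ‖M i l * conj (W k l)‖ = 1 := fun l hl => by
    simp [hWk l hl, hMj l hl]
  have hu : ∀ l, l = p ∨ l = q ∨ l = r → ‖conj (M i l) * M i' l‖ = 1 := by
    intro l hl
    simp [hMi l (Or.inr hl), hMi' l (Or.inr hl)]
  have huvw : conj (M i p) * M i' p + conj (M i q) * M i' q + conj (M i r) * M i' r = 0 := by
    have h1 := hM.sum_mul_conj i' i
    rw [if_neg hi', hsum, hs, hi] at h1
    simp only [map_zero, mul_zero, zero_mul, zero_add] at h1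
    linear_combination h1
  have hS : ∑ l, M i l * conj (W k l) = M i s * conj (W k s) + M i p * conj (W k p) +
      M i q * conj (W k q) + M i r * conj (W k r) := by
    rw [hsum, hi]
    ring
  have hT : ∑ l, M i' l * conj (W k l) =
      M i p * conj (W k p) * (conj (M i p) * M i' p) +
      M i q * conj (W k q) * (conj (M i q) * M i' q) +
      M i r * conj (W k r) * (conj (M i r) * M i' r) := by
    rw [hsum, hk, hs]
    simp only [map_zero]
    linear_combination (-conj (W k p) * M i' p) * conj_mul_self_of_norm_eq_one hp +
      (-conj (W k q) * M i' q) * conj_mul_self_of_norm_eq_one hq +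
      (-conj (W k r) * M i' r) * conj_mul_self_of_norm_eq_one hr
  have hSn := h.norm_sum i k
  have hTn := h.norm_sum i' k
  rw [hS] at hSn hzero
  rw [hT] at hTn hzero
  have key : (M i s * conj (W k s) = M i p * conj (W k p) ∨
        M i s * conj (W k s) = -(M i p * conj (W k p))) ∧
      (M i q * conj (W k q) = M i p * conj (W k p) ∨
        M i q * conj (W k q) = -(M i p * conj (W k p))) ∧
      (M i r * conj (W k r) = M i p * conj (W k p) ∨
        M i r * conj (W k r) = -(M i p * conj (W k p))) := by
    rcases hzero with h0 | h0
    · exact eq_or_eq_neg_of_sum_eq_zero (hx p (hne p hp)) (hx q (hne q hq)) (hx r (hne r hr))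
        (hx s (hne s hs1)) (hu p (by simp)) (hu q (by simp)) (hu r (by simp)) huvw h0 hTn
    · obtain ⟨h1, h2, h3⟩ := eq_of_weighted_sum_eq_zero (hx p (hne p hp)) (hx q (hne q hq))
        (hx r (hne r hr)) (hx s (hne s hs1)) (hu p (by simp)) (hu q (by simp)) (hu r (by simp))
        huvw h0 hSn
      exact ⟨Or.inr h1, Or.inl h2, Or.inl h3⟩
  refine ⟨p, hx p (hne p hp), fun l hl => ?_⟩
  rcases hcov l with rfl | rfl | rfl | rfl | rfl
  · exact absurd rfl hl
  · exact key.1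
  · exact Or.inl rfl
  · exact key.2.1
  · exact key.2.2

/-- Rows with a common zero in two unbiased `UW(5, 4)` agree up to signs and a scalar. -/
lemma Unbiased.exists_row_signs (h : Unbiased 4 M W) {i k j : Fin 5} (hi : M i j = 0)
    (hk : W k j = 0) : ∃ c : ℂ, ‖c‖ = 1 ∧ ∃ e : Fin 5 → ℤˣ,
      ∀ l, W k l = c * M i l * ((e l : ℤ) : ℂ) := by
  have hM := h.1
  obtain ⟨p, hp, hl⟩ := h.ratio_eq_or_eq_neg hi hk
  refine ⟨conj (M i p * conj (W k p)), by simpa using hp, ?_⟩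
  have hex : ∀ l, ∃ e : ℤˣ, W k l = conj (M i p * conj (W k p)) * M i l * ((e : ℤ) : ℂ) := by
    intro l
    by_cases hlj : l = j
    · subst hlj
      exact ⟨1, by simp [hi, hk]⟩
    · have h1 : conj (M i l) * M i l = 1 := conj_mul_self_of_norm_eq_one
        (hM.norm_eq_one fun h0 => hlj ((hM.existsUnique_zero i).unique h0 hi))
      rcases hl l hlj with h2 | h2
      · refine ⟨1, ?_⟩
        rw [← h2]
        simp only [map_mul, Complex.conj_conj, Units.val_one, Int.cast_one]
        linear_combination -W k l * h1
      · refine ⟨-1, ?_⟩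
        rw [eq_neg_iff_add_eq_zero, add_comm, ← eq_neg_iff_add_eq_zero] at h2
        rw [h2]
        simp only [map_neg, map_mul, Complex.conj_conj, Units.val_one, Int.cast_one, Units.val_neg,
          Int.cast_neg]
        linear_combination -W k l * h1
  choose e he using hex
  exact ⟨e, he⟩

/-! ### Column signs -/

variable {K : Matrix (Fin 5) (Fin 5) ℂ}

/-- `K` arises from `M` by signing the columns by `t` and then permuting and rescaling the rows. -/
def SignScaling (M K : Matrix (Fin 5) (Fin 5) ℂ) (t : Fin 5 → ℤˣ) : Prop :=
  ∃ (σ : Equiv.Perm (Fin 5)) (c : Fin 5 → ℂ), (∀ i, ‖c i‖ = 1) ∧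
    ∀ i l, K i l = c i * M (σ i) l * ((t l : ℤ) : ℂ)

/-- Sign patterns of five rows, pairwise proportional off their zeros, come from a signing of the
columns. -/
lemma exists_column_signs (s : Fin 5 → Fin 5 → ℤˣ)
    (H : ∀ j j' k l, j ≠ j' → k ≠ j → k ≠ j' → l ≠ j → l ≠ j' →
      s j k * s j' k = s j l * s j' l) :
    ∃ t ε : Fin 5 → ℤˣ, ∏ k, t k = 1 ∧ ∀ j k, k ≠ j → s j k = ε j * t k := by
  have hfree : ∀ j j' : Fin 5, ∃ l, l ≠ 0 ∧ l ≠ j ∧ l ≠ j' := by decide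
  choose f hf0 hf hf' using hfree
  have sq : ∀ x : ℤˣ, x * x = 1 := Int.units_mul_self
  obtain ⟨ε, hε⟩ : ∃ ε : Fin 5 → ℤˣ, ∀ j k, k ≠ j → k ≠ 0 → s j k = ε j * s 0 k := by
    refine ⟨fun j => if j = 0 then 1 else s j (f j j) * s 0 (f j j), fun j k hkj hk0 => ?_⟩
    by_cases hj : j = 0
    · simp [hj]
    · simp only [hj, if_false]
      rw [← H j 0 k (f j j) hj hkj hk0 (hf _ _) (hf0 _ _), mul_assoc, sq, mul_one]
  -- Row 0 says nothing about column 0, so the sign there is read off row 1; the other rows match it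
  -- via a further column common with row 1.
  have hε1 : ∀ j, j ≠ 0 → s j 0 = ε j * (s 1 0 * ε 1) := by
    intro j hj
    by_cases hj1 : j = 1
    · subst hj1
      rw [mul_comm (s 1 0), ← mul_assoc, sq, one_mul]
    · have h1 := H 1 j 0 (f 1 j) (Ne.symm hj1) (by decide) hj.symm (hf _ _) (hf' _ _)
      rw [hε 1 _ (hf _ _) (hf0 _ _), hε j _ (hf' _ _) (hf0 _ _)] at h1
      have h2 : s 1 0 * s j 0 = ε 1 * ε j := by
        rw [h1, mul_mul_mul_comm, sq, mul_one]
      calc s j 0 = s 1 0 * (s 1 0 * s j 0) := by rw [← mul_assoc, sq, one_mul]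
        _ = ε j * (s 1 0 * ε 1) := by
          rw [h2]
          ac_rfl
  set t : Fin 5 → ℤˣ := fun k => if k = 0 then s 1 0 * ε 1 else s 0 k with ht
  have hst : ∀ j k, k ≠ j → s j k = (if j = 0 then 1 else ε j) * t k := by
    intro j k hkj
    by_cases hj : j = 0
    · subst hj
      simp [ht, hkj]
    · by_cases hk : k = 0
      · subst hk
        simp [ht, hj, hε1 j hj]
      · simp [ht, hj, hk, hε j k hkj hk]
  -- Only the products `ε j * t k` matter, so both may be multiplied by the sign `∏ l, t l`; the new
  -- product is its sixth power.
  refine ⟨fun k => (∏ l, t l) * t k, fun j => (∏ l, t l) * if j = 0 then 1 else ε j, ?_, ?_⟩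
  · rw [Finset.prod_mul_distrib, Finset.prod_const, ← pow_succ, Finset.card_univ, Fintype.card_fin]
    rw [show 5 + 1 = 2 * 3 from rfl, pow_mul, pow_two, sq, one_pow]
  · intro j k hkj
    rw [hst j k hkj, mul_mul_mul_comm, sq, one_mul]

lemma signs_eq_of_sum_eq_zero {u v w : ℂ} (hu : ‖u‖ = 1) (hv : ‖v‖ = 1) (hw : ‖w‖ = 1)
    (h : u + v + w = 0) {x y z : ℤˣ}
    (h' : ((x : ℤ) : ℂ) * u + ((y : ℤ) : ℂ) * v + ((z : ℤ) : ℂ) * w = 0) : x = y ∧ x = z := by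
  have u0 := ne_zero_of_norm_eq_one hu
  have v0 := ne_zero_of_norm_eq_one hv
  have w0 := ne_zero_of_norm_eq_one hw
  rcases Int.units_eq_one_or x with rfl | rfl <;> rcases Int.units_eq_one_or y with rfl | rfl <;>
    rcases Int.units_eq_one_or z with rfl | rfl <;>
    simp only [Units.val_one, Units.val_neg, Int.cast_one, Int.cast_neg] at h'
  · exact ⟨rfl, rfl⟩
  · exact absurd (by linear_combination (1 / 2) * h - (1 / 2) * h') w0
  · exact absurd (by linear_combination (1 / 2) * h - (1 / 2) * h') v0
  · exact absurd (by linear_combination (1 / 2) * h + (1 / 2) * h') u0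
  · exact absurd (by linear_combination (1 / 2) * h - (1 / 2) * h') u0
  · exact absurd (by linear_combination (1 / 2) * h + (1 / 2) * h') v0
  · exact absurd (by linear_combination (1 / 2) * h + (1 / 2) * h') w0
  · exact ⟨rfl, rfl⟩

/-- The sum of three unimodular numbers of zero sum, taken with signs, has absolute value
`0` or `2`. -/
lemma norm_signed_sum {u v w : ℂ} (hu : ‖u‖ = 1) (hv : ‖v‖ = 1) (hw : ‖w‖ = 1)
    (h : u + v + w = 0) (x y z : ℤˣ) :
    ‖((x : ℤ) : ℂ) * u + ((y : ℤ) : ℂ) * v + ((z : ℤ) : ℂ) * w‖ = 0 ∨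
      ‖((x : ℤ) : ℂ) * u + ((y : ℤ) : ℂ) * v + ((z : ℤ) : ℂ) * w‖ = 2 := by
  have double : ∀ S y : ℂ, ‖y‖ = 1 → S = 2 * y ∨ S = -2 * y → ‖S‖ = 0 ∨ ‖S‖ = 2 := by
    rintro S y hy (rfl | rfl) <;> right <;> simp [hy]
  rcases Int.units_eq_one_or x with rfl | rfl <;> rcases Int.units_eq_one_or y with rfl | rfl <;>
    rcases Int.units_eq_one_or z with rfl | rfl <;>
    simp only [Units.val_one, Units.val_neg, Int.cast_one, Int.cast_neg]
  · left
    rw [norm_eq_zero]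
    linear_combination h
  · exact double _ w hw (Or.inr (by linear_combination h))
  · exact double _ v hv (Or.inr (by linear_combination h))
  · exact double _ u hu (Or.inl (by linear_combination -h))
  · exact double _ u hu (Or.inr (by linear_combination h))
  · exact double _ v hv (Or.inl (by linear_combination -h))
  · exact double _ w hw (Or.inl (by linear_combination -h))
  · left
    rw [norm_eq_zero]
    linear_combination -h

lemma conj_int (n : ℤ) : conj (n : ℂ) = n := map_intCast _ n

lemma IsUW.common_columns (hM : IsUW 4 M) {i k j s : Fin 5} (hik : i ≠ k) (hi : M i j = 0)
    (hk : M k s = 0) : ∃ p q r : Fin 5, (∀ l, l = j ∨ l = s ∨ l = p ∨ l = q ∨ l = r) ∧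
      ‖M i p * conj (M k p)‖ = 1 ∧ ‖M i q * conj (M k q)‖ = 1 ∧ ‖M i r * conj (M k r)‖ = 1 ∧
      M i p * conj (M k p) + M i q * conj (M k q) + M i r * conj (M k r) = 0 ∧
      ∀ x : Fin 5 → ℤˣ, ∑ l, ((x l : ℤ) : ℂ) * (M i l * conj (M k l)) =
        ((x p : ℤ) : ℂ) * (M i p * conj (M k p)) + ((x q : ℤ) : ℂ) * (M i q * conj (M k q)) +
        ((x r : ℤ) : ℂ) * (M i r * conj (M k r)) := by
  obtain ⟨p, q, r, hcov, hsum, hMi, hMk⟩ := hM.exists_enumeration hik hi hk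
  refine ⟨p, q, r, hcov, ?_, ?_, ?_, ?_, ?_⟩
  · simp [hMi p (by simp), hMk p (by simp)]
  · simp [hMi q (by simp), hMk q (by simp)]
  · simp [hMi r (by simp), hMk r (by simp)]
  · have h1 := hM.sum_mul_conj i k
    rw [if_neg hik, hsum, hi, hk] at h1
    simpa using h1
  · intro x
    rw [hsum, hi, hk]
    simp

/-- A `UW(5, 4)` unbiased with `M` is `M` with signed columns, up to permuting and rescaling the
rows. -/
lemma Unbiased.exists_signScaling (h : Unbiased 4 M W) :
    ∃ t : Fin 5 → ℤˣ, ∏ l, t l = 1 ∧ SignScaling M W t := by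
  have hM := h.1
  have hW := h.2.1
  obtain ⟨z, hz⟩ := hM.exists_perm
  obtain ⟨y, hy⟩ := hW.exists_perm
  have hrow : ∀ j, ∃ c : ℂ, ‖c‖ = 1 ∧ ∃ e : Fin 5 → ℤˣ,
      ∀ l, W (y.symm j) l = c * M (z.symm j) l * ((e l : ℤ) : ℂ) := fun j =>
    h.exists_row_signs ((hz _ j).mpr (by simp)) ((hy _ j).mpr (by simp))
  choose c hc s hs using hrow
  obtain ⟨t, ε, ht, hst⟩ := exists_column_signs s (by
    intro j j' k l hjj hkj hkj' hlj hlj'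
    have hne : z.symm j ≠ z.symm j' := fun h => hjj (z.symm.injective h)
    obtain ⟨p, q, r, hcov, hp, hq, hr, hsum, hsum'⟩ := hM.common_columns hne
      ((hz _ j).mpr (by simp)) ((hz _ j').mpr (by simp))
    have h1 := hW.sum_mul_conj (y.symm j) (y.symm j')
    rw [if_neg fun h => hjj (y.symm.injective h)] at h1
    have h2 : c j * conj (c j') * ∑ l, (((s j l * s j' l : ℤˣ) : ℤ) : ℂ) *
        (M (z.symm j) l * conj (M (z.symm j') l)) = 0 := by
      rw [← h1, Finset.mul_sum]
      refine Finset.sum_congr rfl fun l _ => ?_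
      rw [hs, hs]
      simp only [map_mul, conj_int, Units.val_mul, Int.cast_mul]
      ring
    have h3 : c j * conj (c j') ≠ 0 := ne_zero_of_norm_eq_one (by simp [hc])
    have h4 := (mul_eq_zero.mp h2).resolve_left h3
    rw [hsum' fun l => s j l * s j' l] at h4
    obtain ⟨h5, h6⟩ := signs_eq_of_sum_eq_zero hp hq hr hsum h4
    have key : ∀ l, l ≠ j → l ≠ j' → s j l * s j' l = s j p * s j' p := by
      intro l hl hl'
      rcases hcov l with rfl | rfl | rfl | rfl | rfl
      · exact absurd rfl hl
      · exact absurd rfl hl'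
      · rfl
      · exact h5.symm
      · exact h6.symm
    rw [key k hkj hkj', key l hlj hlj'])
  refine ⟨t, ht, y.trans z.symm, fun i => c (y i) * ((ε (y i) : ℤ) : ℂ), ?_, ?_⟩
  · intro i
    rcases Int.units_eq_one_or (ε (y i)) with h | h <;> simp [h, hc]
  · intro i l
    have h1 := hs (y i) l
    rw [y.symm_apply_apply] at h1
    rw [h1]
    by_cases hl : l = y i
    · have : M (z.symm (y i)) l = 0 := (hz _ _).mpr (by simp [hl])
      simp [this]
    · rw [hst _ _ hl]
      simp only [Units.val_mul, Int.cast_mul, Equiv.trans_apply]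
      ring

lemma SignScaling.refl (M : Matrix (Fin 5) (Fin 5) ℂ) : SignScaling M M 1 :=
  ⟨1, 1, by simp, by simp⟩

lemma SignScaling.isUW {t : Fin 5 → ℤˣ} (hM : IsUW 4 M) (h : SignScaling M K t) : IsUW 4 K := by
  obtain ⟨σ, c, hc, hK⟩ := h
  refine ⟨fun i j => ?_, ?_⟩
  · rw [hK]
    rcases Int.units_eq_one_or (t j) with h | h <;> simpa [h, hc] using hM.1 (σ i) j
  · ext i k
    have h1 := hM.sum_mul_conj (σ i) (σ k)
    have h2 : (K * Kᴴ) i k = c i * conj (c k) * ∑ l, M (σ i) l * conj (M (σ k) l) := by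
      rw [Matrix.mul_apply, Finset.mul_sum]
      refine Finset.sum_congr rfl fun l _ => ?_
      rw [Matrix.conjTranspose_apply, hK, hK]
      rcases Int.units_eq_one_or (t l) with h | h <;> simp [h] <;> ring
    rw [h2, h1]
    by_cases hik : i = k
    · subst hik
      rw [mul_comm (c i), conj_mul_self_of_norm_eq_one (hc i)]
      simp
    · simp [hik]

/-- Gram entries of two sign scalings of the same matrix. -/
lemma sum_mul_conj_of_signScaling {σ τ : Equiv.Perm (Fin 5)} {c d : Fin 5 → ℂ} {t t' : Fin 5 → ℤˣ}
    (hK : ∀ i l, K i l = c i * M (σ i) l * ((t l : ℤ) : ℂ))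
    (hW : ∀ i l, W i l = d i * M (τ i) l * ((t' l : ℤ) : ℂ)) (i k : Fin 5) :
    ∑ l, K i l * conj (W k l) = c i * conj (d k) *
      ∑ l, (((t l * t' l : ℤˣ) : ℤ) : ℂ) * (M (σ i) l * conj (M (τ k) l)) := by
  rw [Finset.mul_sum]
  refine Finset.sum_congr rfl fun l _ => ?_
  rw [hK, hW]
  simp only [map_mul, conj_int, Units.val_mul, Int.cast_mul]
  ring

lemma IsUW.sum_signs_self (hM : IsUW 4 M) {m j : Fin 5} (hm : M m j = 0) (x : Fin 5 → ℤˣ) :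
    ∑ l, ((x l : ℤ) : ℂ) * (M m l * conj (M m l)) = ((∑ l ∈ {j}ᶜ, (x l : ℤ) : ℤ) : ℂ) := by
  rw [Fintype.sum_eq_add_sum_compl j, hm, Int.cast_sum]
  simp only [zero_mul, mul_zero, zero_add]
  refine Finset.sum_congr rfl fun l hl => ?_
  rw [mul_comm (M m l), conj_mul_self_of_norm_eq_one (hM.norm_eq_one fun h0 => ?_), mul_one]
  have := (hM.existsUnique_zero m).unique h0 hm
  simp [this] at hl

/-- The rows of `K` and `W` that come from the row of `M` vanishing at `j` have this sum as inner
product, up to a unimodular factor. -/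
lemma Unbiased.natAbs_sum_signs {t t' : Fin 5 → ℤˣ} (hM : IsUW 4 M) (hK : SignScaling M K t)
    (hW : SignScaling M W t') (h : Unbiased 4 K W) (j : Fin 5) :
    (∑ l ∈ {j}ᶜ, ((t l * t' l : ℤˣ) : ℤ)).natAbs ≠ 4 := by
  obtain ⟨σ, c, hc, hK⟩ := hK
  obtain ⟨τ, d, hd, hW⟩ := hW
  obtain ⟨z, hz⟩ := hM.exists_perm
  have h1 := h.norm_sum (σ.symm (z.symm j)) (τ.symm (z.symm j))
  rw [sum_mul_conj_of_signScaling hK hW] at h1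
  simp only [Equiv.apply_symm_apply] at h1
  rw [hM.sum_signs_self ((hz _ j).mpr (by simp)), norm_mul, norm_mul, RCLike.norm_conj, hc, hd,
    one_mul, one_mul, Complex.norm_intCast, ← Int.cast_abs] at h1
  intro h4
  rw [Int.abs_eq_natAbs, h4] at h1
  norm_num at h1

/-- Only rows coming from the same row of `M` need the hypothesis: for different rows the inner
product is a signed triangle sum, covered by `norm_signed_sum`. -/
lemma unbiased_of_signScaling {t t' : Fin 5 → ℤˣ} (hM : IsUW 4 M) (hK : SignScaling M K t)
    (hW : SignScaling M W t')
    (h : ∀ j, (∑ l ∈ {j}ᶜ, ((t l * t' l : ℤˣ) : ℤ)).natAbs = 0 ∨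
      (∑ l ∈ {j}ᶜ, ((t l * t' l : ℤˣ) : ℤ)).natAbs = 2) : Unbiased 4 K W := by
  have hKU := hK.isUW hM
  have hWU := hW.isUW hM
  obtain ⟨σ, c, hc, hK⟩ := hK
  obtain ⟨τ, d, hd, hW⟩ := hW
  obtain ⟨z, hz⟩ := hM.exists_perm
  refine ⟨hKU, hWU, (2 : ℂ)⁻¹ • (K * Wᴴ), ⟨fun i k => ?_, ?_⟩, ?_⟩
  · have h1 : (K * Wᴴ) i k = ∑ l, K i l * conj (W k l) := by simp [Matrix.mul_apply]
    have h2 : ‖(K * Wᴴ) i k‖ = 0 ∨ ‖(K * Wᴴ) i k‖ = 2 := by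
      rw [h1, sum_mul_conj_of_signScaling hK hW, norm_mul, norm_mul, RCLike.norm_conj, hc, hd,
        one_mul, one_mul]
      by_cases hik : σ i = τ k
      · rw [hik, hM.sum_signs_self ((hz (τ k) (z (τ k))).mpr rfl), Complex.norm_intCast,
          ← Int.cast_abs, Int.abs_eq_natAbs]
        rcases h (z (τ k)) with h | h <;> rw [h] <;> norm_num
      · obtain ⟨p, q, r, -, hp, hq, hr, hsum, hsum'⟩ := hM.common_columns hik
          ((hz _ _).mpr rfl) ((hz _ _).mpr rfl)
        rw [hsum' fun l => t l * t' l]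
        exact norm_signed_sum hp hq hr hsum _ _ _
    rcases h2 with h2 | h2 <;> simp [h2]
  · rw [Matrix.conjTranspose_smul, Matrix.conjTranspose_mul, Matrix.conjTranspose_conjTranspose,
      Matrix.smul_mul, Matrix.mul_smul, Matrix.mul_assoc, ← Matrix.mul_assoc Wᴴ,
      hWU.conjTranspose_mul, Matrix.smul_mul, Matrix.one_mul, Matrix.mul_smul, hKU.2]
    simp only [smul_smul]
    norm_num
  · rw [sqrt_four, smul_smul]
    norm_num

lemma Unbiased.ne (h : Unbiased 4 K W) : K ≠ W := by
  rintro rfl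
  have h1 := h.norm_sum 0 0
  rw [h.1.sum_mul_conj] at h1
  norm_num at h1

/-! ### The upper bound -/

/-- The number of minus signs is even. It is not zero, and not four, since omitting the single plus
would leave -4; so it is two. -/
lemma sum_signs_eq_one : ∀ x : Fin 5 → ℤˣ, ∏ l, x l = 1 →
    (∀ j, (∑ l ∈ {j}ᶜ, (x l : ℤ)).natAbs ≠ 4) → ∑ l, (x l : ℤ) = 1 := by
  decide

/-- The Gram matrix is `4 I + J`, with `J` the all-ones matrix, hence positive definite. -/
lemma linearIndependent_of_equiangular {ι n : Type*} [Fintype n] [DecidableEq ι] (v : ι → n → ℝ)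
    (h : ∀ i k, v i ⬝ᵥ v k = if i = k then 5 else 1) : LinearIndependent ℝ v := by
  rw [linearIndependent_iff']
  intro s g hg
  have h1 : ∀ k ∈ s, 4 * g k + ∑ i ∈ s, g i = 0 := by
    intro k hk
    have h2 := congrArg (fun x => x ⬝ᵥ v k) hg
    simp only [sum_dotProduct, smul_dotProduct, h, zero_dotProduct, smul_eq_mul] at h2
    rw [← h2]
    have h3 : ∀ i, g i * (if i = k then (5 : ℝ) else 1) = g i + if i = k then 4 * g i else 0 := by
      intro i
      split_ifs <;> ring
    simp only [h3, Finset.sum_add_distrib, Finset.sum_ite_eq', hk, if_true]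
    ring
  have h4 : (4 + (s.card : ℝ)) * ∑ i ∈ s, g i = 0 := by
    have h5 := Finset.sum_eq_zero h1
    rw [Finset.sum_add_distrib, ← Finset.mul_sum, Finset.sum_const, nsmul_eq_mul] at h5
    linear_combination h5
  have h6 : ∑ i ∈ s, g i = 0 := (mul_eq_zero.mp h4).resolve_left (by positivity)
  intro k hk
  have := h1 k hk
  rw [h6] at this
  linarith

/-- There are at most five mutually unbiased `UW(5, 4)`. -/
lemma MutuallyUnbiased.encard_le {S : Set (Matrix (Fin 5) (Fin 5) ℂ)} (h : MutuallyUnbiased 4 S) :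
    S.encard ≤ 5 := by
  classical
  rcases S.eq_empty_or_nonempty with rfl | ⟨M, hMS⟩
  · simp
  have hM := h.1 M hMS
  -- The base matrix `M` is encoded by the all-ones vector.
  have hex : ∀ K : S, ∃ t : Fin 5 → ℤˣ, ∏ l, t l = 1 ∧ SignScaling M K t := by
    rintro ⟨K, hK⟩
    by_cases hMK : M = K
    · subst hMK
      exact ⟨1, by simp, SignScaling.refl M⟩
    · exact (h.2 hMS hK hMK).exists_signScaling
  choose t ht hst using hex
  have hli : LinearIndependent ℝ fun (K : S) (l : Fin 5) => (((t K l : ℤˣ) : ℤ) : ℝ) := by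
    refine linearIndependent_of_equiangular _ fun K W => ?_
    have hdot : (fun l => (((t K l : ℤˣ) : ℤ) : ℝ)) ⬝ᵥ (fun l => (((t W l : ℤˣ) : ℤ) : ℝ)) =
        ((∑ l, ((t K l * t W l : ℤˣ) : ℤ) : ℤ) : ℝ) := by
      simp [dotProduct]
    rw [hdot]
    split_ifs with hKW
    · subst hKW
      simp [Int.units_mul_self]
    · rw [sum_signs_eq_one (fun l => t K l * t W l)
        (by rw [Finset.prod_mul_distrib, ht, ht, one_mul])
        (Unbiased.natAbs_sum_signs hM (hst K) (hst W)
          (h.2 K.2 W.2 fun h => hKW (Subtype.ext h)))]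
      norm_num
  have : Finite S := hli.finite
  have := Fintype.ofFinite S
  have hcard := hli.fintype_card_le_finrank
  rw [Module.finrank_fintype_fun_eq_card, Fintype.card_fin] at hcard
  rw [Set.encard_eq_coe_toFinset_card, Set.toFinset_card]
  exact_mod_cast hcard

/-! ### Uniqueness up to equivalence -/

variable {V : Matrix (Fin 5) (Fin 5) ℂ}

/-- `W` arises from `V` by permuting rows and columns and rescaling them by unimodular factors. -/
def Monomial (W V : Matrix (Fin 5) (Fin 5) ℂ) : Prop :=
  ∃ (σ τ : Equiv.Perm (Fin 5)) (c d : Fin 5 → ℂ), (∀ i, ‖c i‖ = 1) ∧ (∀ j, ‖d j‖ = 1) ∧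
    ∀ i j, W i j = c i * V (σ i) (τ j) * d j

lemma Monomial.symm (h : Monomial W V) : Monomial V W := by
  obtain ⟨σ, τ, c, d, hc, hd, h⟩ := h
  refine ⟨σ.symm, τ.symm, fun i => conj (c (σ.symm i)), fun j => conj (d (τ.symm j)),
    by simp [hc], by simp [hd], fun i j => ?_⟩
  rw [h, Equiv.apply_symm_apply, Equiv.apply_symm_apply]
  have h1 := conj_mul_self_of_norm_eq_one (hc (σ.symm i))
  have h2 := conj_mul_self_of_norm_eq_one (hd (τ.symm j))
  linear_combination (-V i j) * h1 -
    conj (c (σ.symm i)) * c (σ.symm i) * V i j * h2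

lemma Monomial.trans {U : Matrix (Fin 5) (Fin 5) ℂ} (h : Monomial W V) (h' : Monomial V U) :
    Monomial W U := by
  obtain ⟨σ, τ, c, d, hc, hd, h⟩ := h
  obtain ⟨σ', τ', c', d', hc', hd', h'⟩ := h'
  refine ⟨σ.trans σ', τ.trans τ', fun i => c i * c' (σ i), fun j => d' (τ j) * d j,
    by simp [hc, hc'], by simp [hd, hd'], fun i j => ?_⟩
  rw [h, h']
  simp only [Equiv.trans_apply]
  ring

lemma Monomial.isUW (h : Monomial W V) (hV : IsUW 4 V) : IsUW 4 W := by
  obtain ⟨σ, τ, c, d, hc, hd, h⟩ := h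
  refine ⟨fun i j => ?_, ?_⟩
  · rw [h, norm_mul, norm_mul, hc, hd, one_mul, mul_one]
    exact hV.1 _ _
  · ext i k
    have h1 := hV.sum_mul_conj (σ i) (σ k)
    rw [← Equiv.sum_comp τ] at h1
    have h2 : (W * Wᴴ) i k =
        c i * conj (c k) * ∑ l, V (σ i) (τ l) * conj (V (σ k) (τ l)) := by
      rw [Matrix.mul_apply, Finset.mul_sum]
      refine Finset.sum_congr rfl fun l _ => ?_
      rw [Matrix.conjTranspose_apply, h, h]
      simp only [RCLike.star_def, map_mul]
      linear_combination c i * conj (c k) * V (σ i) (τ l) * conj (V (σ k) (τ l)) *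
        conj_mul_self_of_norm_eq_one (hd l)
    rw [h2, h1]
    by_cases hik : i = k
    · subst hik
      rw [mul_comm (c i), conj_mul_self_of_norm_eq_one (hc i)]
      simp
    · simp [hik]

lemma isUnimodularPerm_of_perm (σ : Equiv.Perm (Fin 5)) {c : Fin 5 → ℂ} (hc : ∀ i, ‖c i‖ = 1) :
    IsUnimodularPerm (Matrix.of fun i k => if k = σ i then c i else 0) := by
  have h0 : ∀ i, c i ≠ 0 := fun i => ne_zero_of_norm_eq_one (hc i)
  refine ⟨fun i => ⟨σ i, by simp [h0], fun k hk => ?_⟩,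
    fun k => ⟨σ.symm k, by simp [h0], fun i hi => ?_⟩, fun i k hik => ?_⟩
  · by_contra hne
    simp [hne] at hk
  · by_contra hne
    have : k ≠ σ i := fun h => hne (by simp [h])
    simp [this] at hi
  · by_cases h : k = σ i
    · simp [h, hc]
    · simp [h] at hik

lemma Monomial.equivalent (h : Monomial W V) : Equivalent W V := by
  obtain ⟨σ, τ, c, d, hc, hd, h⟩ := h
  refine ⟨Matrix.of fun i k => if k = σ i then c i else 0,
    Matrix.of fun k j => if k = τ j then d j else 0, isUnimodularPerm_of_perm σ hc, ?_, ?_⟩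
  · have h1 := isUnimodularPerm_of_perm τ.symm (c := fun k => d (τ.symm k)) (fun k => hd _)
    convert h1 using 2
    ext k j
    by_cases hk : k = τ j
    · simp [hk]
    · have : j ≠ τ.symm k := fun h => hk (by simp [h])
      simp [hk, this]
  · ext i j
    simp [Matrix.mul_apply, h]

/-- A normal form of the `UW(5, 4)`, with zero diagonal. -/
noncomputable def conferenceForm : Matrix (Fin 5) (Fin 5) ℂ :=
  !![0, 1, 1, 1, 1;
     1, 0, 1, a, a ^ 2;
     1, 1, 0, a ^ 2, a;
     1, a, a ^ 2, 0, 1;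
     1, a ^ 2, a, 1, 0]

lemma ne_of_add_add_eq_zero {p y y' : ℂ} (hp : ‖p‖ = 1) (hy : ‖y‖ = 1) (h : p + y + y' = 0) :
    y ≠ y' := by
  rintro rfl
  have h1 : p = -2 * y := by linear_combination h
  have h2 := congrArg norm h1
  simp [hp, hy] at h2

lemma eq_a_mul_of_one_add {y y' m m' : ℂ} (hy : ‖y‖ = 1) (hy' : ‖y'‖ = 1) (hm : ‖m‖ = 1)
    (hm' : ‖m'‖ = 1) (h : 1 + y * conj m + y' * conj m' = 0) :
    (y = a * m ∧ y' = a ^ 2 * m') ∨ (y = a ^ 2 * m ∧ y' = a * m') := by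
  have h1 := conj_mul_self_of_norm_eq_one hm
  have h2 := conj_mul_self_of_norm_eq_one hm'
  rcases eq_a_mul_of_sum_eq_zero (by simp) (by simp [hy, hm]) (by simp [hy', hm']) h with
    ⟨h3, h4⟩ | ⟨h3, h4⟩
  · exact Or.inl ⟨by linear_combination m * h3 - y * h1, by linear_combination m' * h4 - y' * h2⟩
  · exact Or.inr ⟨by linear_combination m * h3 - y * h1, by linear_combination m' * h4 - y' * h2⟩

lemma IsUW.exists_zero_diagonal (hW : IsUW 4 W) :
    ∃ V, Monomial W V ∧ IsUW 4 V ∧ ∀ i j, V i j = 0 ↔ i = j := by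
  obtain ⟨z, hz⟩ := hW.exists_perm
  have h : Monomial (Matrix.of fun i j => W i (z j)) W :=
    ⟨1, z, 1, 1, by simp, by simp, by simp⟩
  exact ⟨_, h.symm, h.isUW hW, fun i j => by simp [hz, eq_comm]⟩

lemma IsUW.exists_normalized (hW : IsUW 4 W) :
    ∃ V, Monomial W V ∧ IsUW 4 V ∧ (∀ i j, V i j = 0 ↔ i = j) ∧ (∀ j, j ≠ 0 → V 0 j = 1) ∧
      ∀ i, i ≠ 0 → V i 0 = 1 := by
  obtain ⟨V, hWV, hV, hz⟩ := hW.exists_zero_diagonal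
  have hn : ∀ i j, i ≠ j → ‖V i j‖ = 1 := fun i j hij => hV.norm_eq_one (by simpa [hz] using hij)
  set c : Fin 5 → ℂ := fun i => if i = 0 then 1 else conj (V i 0) with hc
  set d : Fin 5 → ℂ := fun j => if j = 0 then 1 else conj (V 0 j) with hd
  have hc1 : ∀ i, ‖c i‖ = 1 := by
    intro i
    by_cases hi : i = 0
    · simp [hc, hi]
    · simp [hc, hi, hn i 0 hi]
  have hd1 : ∀ j, ‖d j‖ = 1 := by
    intro j
    by_cases hj : j = 0
    · simp [hd, hj]
    · simp [hd, hj, hn 0 j (Ne.symm hj)]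
  have h : Monomial (Matrix.of fun i j => c i * V i j * d j) V :=
    ⟨1, 1, c, d, hc1, hd1, by simp⟩
  refine ⟨_, hWV.trans h.symm, h.isUW hV, fun i j => ?_, fun j hj => ?_, fun i hi => ?_⟩
  · simp [ne_zero_of_norm_eq_one (hc1 i), ne_zero_of_norm_eq_one (hd1 j), hz]
  · have := conj_mul_self_of_norm_eq_one (hn 0 j (Ne.symm hj))
    simp only [Matrix.of_apply, hc, hd, hj, if_true, if_false]
    linear_combination this
  · have := conj_mul_self_of_norm_eq_one (hn i 0 hi)
    simp only [Matrix.of_apply, hc, hd, hi, if_true, if_false]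
    linear_combination this

lemma IsUW.exists_normalized_oriented (hW : IsUW 4 W) :
    ∃ V, Monomial W V ∧ IsUW 4 V ∧ (∀ i j, V i j = 0 ↔ i = j) ∧ (∀ j, j ≠ 0 → V 0 j = 1) ∧
      (∀ i, i ≠ 0 → V i 0 = 1) ∧ V 1 3 = a * V 1 2 ∧ V 1 4 = a ^ 2 * V 1 2 := by
  obtain ⟨V, hWV, hV, hz, hr, hc⟩ := hW.exists_normalized
  have hn : ∀ i j, i ≠ j → ‖V i j‖ = 1 := fun i j hij => hV.norm_eq_one (by simpa [hz] using hij)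
  have h1 := hV.sum_mul_conj 1 0
  rw [if_neg (by decide), Fin.sum_univ_five, (hz 0 0).mpr rfl, (hz 1 1).mpr rfl, hr 2 (by decide),
    hr 3 (by decide), hr 4 (by decide)] at h1
  simp only [map_zero, mul_zero, map_one, mul_one, zero_mul, zero_add] at h1
  rcases eq_a_mul_of_sum_eq_zero (hn 1 2 (by decide)) (hn 1 3 (by decide)) (hn 1 4 (by decide)) h1
    with ⟨h2, h3⟩ | ⟨h2, h3⟩
  · exact ⟨V, hWV, hV, hz, hr, hc, h2, h3⟩
  -- Swapping 3 and 4 in rows and columns together keeps the zero diagonal and the border and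
  -- reverses the orientation.
  · set π : Equiv.Perm (Fin 5) := Equiv.swap 3 4
    have h : Monomial (Matrix.of fun i j => V (π i) (π j)) V :=
      ⟨π, π, 1, 1, by simp, by simp, by simp⟩
    have hπ : ∀ i, i ≠ 0 → π i ≠ 0 := by decide
    have e0 : π 0 = 0 := by decide
    have e1 : π 1 = 1 := by decide
    have e2 : π 2 = 2 := by decide
    have e3 : π 3 = 4 := by decide
    have e4 : π 4 = 3 := by decide
    refine ⟨_, hWV.trans h.symm, h.isUW hV, fun i j => by simp [hz], fun j hj => ?_,
      fun i hi => ?_, ?_, ?_⟩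
    · simp only [Matrix.of_apply, e0, hr _ (hπ j hj)]
    · simp only [Matrix.of_apply, e0, hc _ (hπ i hi)]
    · simp only [Matrix.of_apply, e1, e2, e3, h3]
    · simp only [Matrix.of_apply, e1, e2, e4, h2]

/-- Orthogonality to row 1 leaves two candidates for each remaining row. One would have two equal
entries in a zero sum of three unimodular numbers, which is impossible. The whole core is then a
multiple of `V 1 2`. -/
lemma IsUW.monomial_conferenceForm (hW : IsUW 4 W) : Monomial W conferenceForm := by
  obtain ⟨V, hWV, hV, hz, hr, hc, h13, h14⟩ := hW.exists_normalized_oriented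
  refine hWV.trans ?_
  have hn : ∀ i j, i ≠ j → ‖V i j‖ = 1 := fun i j hij => hV.norm_eq_one (by simpa [hz] using hij)
  have ha := a_pow_three
  have hA := one_add_a_add_sq
  have hd : ∀ i, V i i = 0 := fun i => (hz i i).mpr rfl
  have hx := hn 1 2 (by decide)
  have row : ∀ i, i ≠ 0 → V i 1 + V i 2 + V i 3 + V i 4 = 0 := by
    intro i hi
    have h1 := hV.sum_mul_conj i 0
    rw [if_neg hi, Fin.sum_univ_five, hd 0, hr 1 (by decide), hr 2 (by decide), hr 3 (by decide),
      hr 4 (by decide)] at h1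
    simpa using h1
  have pair : ∀ i, i ≠ 0 → i ≠ 1 → 1 + V i 2 * conj (V 1 2) + V i 3 * conj (V 1 3) +
      V i 4 * conj (V 1 4) = 0 := by
    intro i hi hi1
    have h1 := hV.sum_mul_conj i 1
    rw [if_neg hi1, Fin.sum_univ_five, hd 1, hc i hi, hc 1 (by decide)] at h1
    simpa using h1
  have r2 := row 2 (by decide)
  have r3 := row 3 (by decide)
  have r4 := row 4 (by decide)
  have p2 := pair 2 (by decide) (by decide)
  have p3 := pair 3 (by decide) (by decide)
  have p4 := pair 4 (by decide) (by decide)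
  rw [hd] at r2 r3 r4 p2 p3 p4
  simp only [zero_mul, add_zero] at r2 r3 r4 p2 p3 p4
  have n13 := hn 1 3 (by decide)
  have n14 := hn 1 4 (by decide)
  obtain ⟨h21, h23, h24⟩ : V 2 1 = V 1 2 ∧ V 2 3 = a ^ 2 * V 1 2 ∧ V 2 4 = a * V 1 2 := by
    rcases eq_a_mul_of_one_add (hn 2 3 (by decide)) (hn 2 4 (by decide)) n13 n14 p2 with
      ⟨h, h'⟩ | ⟨h, h'⟩ <;> rw [h13] at h <;> rw [h14] at h'
    · exact ⟨by linear_combination r2 - h - h' - a * V 1 2 * ha - V 1 2 * hA,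
        by linear_combination h, by linear_combination h' + a * V 1 2 * ha⟩
    · exact absurd (by linear_combination h - h')
        (ne_of_add_add_eq_zero (hn 2 1 (by decide)) (hn 2 3 (by decide)) r2)
  obtain ⟨h31, h32, h34⟩ : V 3 1 = a * V 1 2 ∧ V 3 2 = a ^ 2 * V 1 2 ∧ V 3 4 = V 1 2 := by
    rcases eq_a_mul_of_one_add (hn 3 2 (by decide)) (hn 3 4 (by decide)) hx n14 p3 with
      ⟨h, h'⟩ | ⟨h, h'⟩ <;> rw [h14] at h'
    · exact absurd (by linear_combination h - h' - a * V 1 2 * ha)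
        (ne_of_add_add_eq_zero (hn 3 1 (by decide)) (hn 3 2 (by decide)) r3)
    · exact ⟨by linear_combination r3 - h - h' - V 1 2 * ha - V 1 2 * hA,
        by linear_combination h, by linear_combination h' + V 1 2 * ha⟩
  obtain ⟨h41, h42, h43⟩ : V 4 1 = a ^ 2 * V 1 2 ∧ V 4 2 = a * V 1 2 ∧ V 4 3 = V 1 2 := by
    rcases eq_a_mul_of_one_add (hn 4 2 (by decide)) (hn 4 3 (by decide)) hx n13 p4 with
      ⟨h, h'⟩ | ⟨h, h'⟩ <;> rw [h13] at h'
    · exact ⟨by linear_combination r4 - h - h' - V 1 2 * ha - V 1 2 * hA,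
        by linear_combination h, by linear_combination h' + V 1 2 * ha⟩
    · exact absurd (by linear_combination h - h')
        (ne_of_add_add_eq_zero (hn 4 1 (by decide)) (hn 4 2 (by decide)) r4)
  have hxx := conj_mul_self_of_norm_eq_one hx
  -- Scaling columns 1 to 4 by `V 1 2` produces the core factor; `conj (V 1 2)` on row 0 keeps its
  -- ones.
  refine ⟨1, 1, ![conj (V 1 2), 1, 1, 1, 1], ![1, V 1 2, V 1 2, V 1 2, V 1 2], ?_, ?_, ?_⟩
  · intro i
    fin_cases i <;> simp [hx]
  · intro i
    fin_cases i <;> simp [hx]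
  · intro i j
    fin_cases i <;> fin_cases j <;> simp [conferenceForm, *]

/-! ### The matrix `W5` and the explicit list -/

lemma isUW_W5 : IsUW 4 W5 := by
  have hA := one_add_a_add_sq
  have hc : conj a = -1 - a := by
    rw [conj_a]
    linear_combination hA
  refine ⟨fun i j => ?_, ?_⟩
  · fin_cases i <;> fin_cases j <;> simp [W5, norm_a]
  · ext i j
    fin_cases i <;> fin_cases j <;>
      simp [W5, Matrix.mul_apply, Fin.sum_univ_five, hc] <;> grind

lemma equivalent_W5 (hW : IsUW 4 W) : Equivalent W W5 :=
  (hW.monomial_conferenceForm.trans isUW_W5.monomial_conferenceForm.symm).equivalent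

lemma W5_pow_six (i j : Fin 5) (h : W5 i j ≠ 0) : W5 i j ^ 6 = 1 := by
  have h6 : a ^ 6 = 1 := by
    rw [show 6 = 3 * 2 from rfl, pow_mul, a_pow_three, one_pow]
  have h12 : (a ^ 2) ^ 6 = 1 := by
    rw [← pow_mul, mul_comm, pow_mul, h6, one_pow]
  fin_cases i <;> fin_cases j <;> simp_all [W5, conj_a]

/-- By sign scaling, all nonzero entries of a row have the same sixth power, and the first of them
is 1. -/
lemma Unbiased.pow_six_eq_one (h : Unbiased 4 W5 W) (hW : RowNormalized W) (i j : Fin 5)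
    (hij : W i j ≠ 0) : W i j ^ 6 = 1 := by
  obtain ⟨t, -, σ, c, hc, hs⟩ := h.exists_signScaling
  have h5 : ∀ l, W i l ≠ 0 → W i l ^ 6 = c i ^ 6 := by
    intro l hl
    rw [hs] at hl ⊢
    rw [mul_pow, mul_pow, W5_pow_six _ _ (right_ne_zero_of_mul (left_ne_zero_of_mul hl))]
    rcases Int.units_eq_one_or (t l) with h | h <;> rw [h] <;> norm_num
  obtain ⟨m, hm, hmin⟩ := WellFounded.has_min (wellFounded_lt (α := Fin 5)) {l | W i l ≠ 0}
    ⟨j, hij⟩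
  have h1 : W i m = 1 := hW i m hm fun k hk => by
    by_contra h0
    exact hmin k h0 hk
  rw [h5 j hij, ← h5 m hm, h1, one_pow]

/-- The column signs that turn `W5` into the listed matrices. -/
def listSigns : Fin 5 → Fin 5 → ℤˣ :=
  ![1, ![1, 1, 1, -1, -1], ![1, 1, -1, 1, -1], ![1, -1, 1, 1, -1], ![1, -1, -1, -1, 1]]

lemma signScaling_listUW54 (i : Fin 5) : SignScaling W5 (listUW54 i) (listSigns i) := by
  -- The last two listed matrices take the rows of `W5` in the order 2, 0, 1, 3, 4; the factor -1 on
  -- the final row makes its leading entry 1.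
  set π : Equiv.Perm (Fin 5) := ⟨![2, 0, 1, 3, 4], ![1, 2, 0, 3, 4], by decide, by decide⟩ with hπ
  fin_cases i
  · exact SignScaling.refl W5
  · refine ⟨1, 1, by simp, fun i l => ?_⟩
    fin_cases i <;> fin_cases l <;> simp [listUW54, listSigns, W5]
  · refine ⟨1, 1, by simp, fun i l => ?_⟩
    fin_cases i <;> fin_cases l <;> simp [listUW54, listSigns, W5]
  · refine ⟨π, ![1, 1, 1, 1, -1], fun i => by fin_cases i <;> simp, fun i l => ?_⟩
    fin_cases i <;> fin_cases l <;> simp [listUW54, listSigns, W5, hπ]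
  · refine ⟨π, ![1, 1, 1, 1, -1], fun i => by fin_cases i <;> simp, fun i l => ?_⟩
    fin_cases i <;> fin_cases l <;> simp [listUW54, listSigns, W5, hπ]

lemma unbiased_listUW54 {i k : Fin 5} (hik : i ≠ k) : Unbiased 4 (listUW54 i) (listUW54 k) := by
  have h : ∀ i k : Fin 5, i ≠ k → ∀ j,
      (∑ l ∈ {j}ᶜ, ((listSigns i l * listSigns k l : ℤˣ) : ℤ)).natAbs = 0 ∨
      (∑ l ∈ {j}ᶜ, ((listSigns i l * listSigns k l : ℤˣ) : ℤ)).natAbs = 2 := by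
    decide
  exact unbiased_of_signScaling isUW_W5 (signScaling_listUW54 i) (signScaling_listUW54 k)
    (h i k hik)

lemma injective_listUW54 : Function.Injective listUW54 := by
  intro i k h
  by_contra hik
  exact (unbiased_listUW54 hik).ne h

lemma mutuallyUnbiased_listUW54 : MutuallyUnbiased 4 (Set.range listUW54) := by
  refine ⟨?_, ?_⟩
  · rintro _ ⟨i, rfl⟩
    exact (signScaling_listUW54 i).isUW isUW_W5
  · rintro _ ⟨i, rfl⟩ _ ⟨k, rfl⟩ hne
    exact unbiased_listUW54 fun h => hne (by rw [h])

end UnitWeighing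

theorem mainTheorem2 :
    -- the largest cardinality of a set of mutually unbiased UW(5,4) is 5
    IsGreatest {c : ℕ∞ | ∃ S : Set (Matrix (Fin 5) (Fin 5) ℂ),
        UnitWeighing.MutuallyUnbiased 4 S ∧ S.encard = c} 5 ∧
    -- every UW(5,4) is equivalent to W₅, which is itself a UW(5,4)
    UnitWeighing.IsUW 4 UnitWeighing.W5 ∧
    (∀ W : Matrix (Fin 5) (Fin 5) ℂ, UnitWeighing.IsUW 4 W →
        UnitWeighing.Equivalent W UnitWeighing.W5) ∧
    -- nonzero entries of a row-normalized matrix unbiased with W₅ are sixth roots of unity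
    (∀ W : Matrix (Fin 5) (Fin 5) ℂ, UnitWeighing.Unbiased 4 UnitWeighing.W5 W →
        UnitWeighing.RowNormalized W → ∀ i j, W i j ≠ 0 → W i j ^ 6 = 1) ∧
    -- the five listed matrices are distinct and form a mutually unbiased set
    Function.Injective UnitWeighing.listUW54 ∧
    UnitWeighing.MutuallyUnbiased 4 (Set.range UnitWeighing.listUW54) := by
  refine ⟨⟨⟨_, UnitWeighing.mutuallyUnbiased_listUW54, ?_⟩, ?_⟩, UnitWeighing.isUW_W5,
    fun W hW => UnitWeighing.equivalent_W5 hW, fun W h hW => h.pow_six_eq_one hW,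
    UnitWeighing.injective_listUW54, UnitWeighing.mutuallyUnbiased_listUW54⟩
  · rw [← Set.image_univ, UnitWeighing.injective_listUW54.encard_image, Set.encard_univ]
    simp
  · rintro _ ⟨S, hS, rfl⟩
    exact hS.encard_le
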